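/- Let $\sigma_1,\kappa,\rho,\delta>0$ and $\sigma_2,\lambda\ge 0$, let $\gamma_{\max}>-\lambda\sigma_1^2+\sqrt{\lambda^2\sigma_1^4+\sigma_1^2\sigma_2^2}$, and let $c:[0,\infty)\to[0,\infty)$ be twice continuously differentiable, strictly increasing and strictly convex. Put \[ f(\gamma,h):=-\Bigl(\frac{1}{\sigma_1^{2}}+h\Bigr)\gamma^2-2\lambda\gamma+\sigma_2^2, \qquad a_1:=\frac{-\delta\rho+\sqrt{\delta^2\rho^2+4\kappa\rho}}{4}, \] \[ a_3:=\frac{2a_1\rho}{\delta\rho+\lambda\rho+2a_1},\qquad a_2:=\frac{a_3(2\rho-a_3)}{2\rho(2\lambda+\delta)},\qquad \bar a:=a_3-a_2(2\lambda+\delta), \] \[ L_v:=\frac{\bar a}{\delta},\qquad M_0:=\gamma_{\max}^2L_v,\qquad h_{\max}:=(c')^{-1}(M_0), \] where it is assumed that $M_0$ lies in the range of $c':[0,\infty)\to[0,\infty)$ (one-sided derivative at $0$), so that $h_{\max}\in[0,\infty)$ is well defined. For a Borel-measurable control $h:[0,\infty)\to[0,h_{\max}]$ and $\gamma_0\in[0,\gamma_{\max}]$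 let $\gamma^{h;\gamma_0}$ be the absolutely continuous solution on $[0,\infty)$ of $\mathrm d\gamma_t=f(\gamma_t,h_t)\,\mathrm dt$ with initial value $\gamma_0$. Then the value function of the reduced deterministic problem, \[ v(\gamma_0):=\inf_{h}\int_0^\infty e^{-\delta t}\bigl(\bar a\,\gamma^{h;\gamma_0}_t+c(h_t)\bigr)\,\mathrm dt,\qquad \gamma_0\in[0,\gamma_{\max}], \] where the infimum is over all Borel-measurable $h:[0,\infty)\to[0,h_{\max}]$, is strictly increasing, strictly concave, and Lipschitz continuous with constant $L_v=\bar a/\delta$ on $[0,\gamma_{\max}]$. -/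

import Mathlib

open Set MeasureTheory

noncomputable section

namespace InfoControl

/-- Parameters of the partially observed control problem with costly information acquisition,
together with the standing assumptions on them. -/
structure Model where
  /-- volatility of the observed state -/
  sigma1 : ℝ
  /-- volatility of the hidden drift -/
  sigma2 : ℝ
  /-- speed of mean reversion of the hidden drift -/
  lam : ℝ
  /-- running cost coefficient of the state -/
  kappa : ℝ
  /-- running cost coefficient of the state control -/
  rho : ℝ
  /-- discount rate -/
  delta : ℝ
  /-- upper end of the state space of the conditional variance -/
  gammaMax : ℝ
  /-- cost of information acquisition; only its values on `[0, ∞)` matter -/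
  c : ℝ → ℝ
  sigma1_pos : 0 < sigma1
  sigma2_nonneg : 0 ≤ sigma2
  lam_nonneg : 0 ≤ lam
  kappa_pos : 0 < kappa
  rho_pos : 0 < rho
  delta_pos : 0 < delta
  /-- `gammaMax` exceeds the stable equilibrium of the uncontrolled conditional variance. -/
  gammaMax_gt :
    -lam * sigma1 ^ 2 + Real.sqrt (lam ^ 2 * sigma1 ^ 4 + sigma1 ^ 2 * sigma2 ^ 2) < gammaMax
  c_nonneg : ∀ x, 0 ≤ x → 0 ≤ c x
  c_strictConvex : StrictConvexOn ℝ (Ici 0) c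
  c_contDiff : ContDiffOn ℝ 2 c (Ici 0)
  c_strictMono : StrictMonoOn c (Ici 0)

namespace Model

variable (M : Model)

/-- Drift of the conditional variance:
`f(γ, h) = -(1/σ₁² + h) γ² - 2 λ γ + σ₂²`. -/
def f (g h : ℝ) : ℝ :=
  -((1 / M.sigma1) ^ 2 + h) * g ^ 2 - 2 * M.lam * g + M.sigma2 ^ 2

def a1 : ℝ :=
  -(M.delta * M.rho) / 4 + Real.sqrt (M.delta ^ 2 * M.rho ^ 2 + 4 * M.kappa * M.rho) / 4

def a3 : ℝ :=
  2 * M.a1 * M.rho / (M.delta * M.rho + M.lam * M.rho + 2 * M.a1)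

def a2 : ℝ :=
  M.a3 * (2 * M.rho - M.a3) / (2 * M.rho * (2 * M.lam + M.delta))

/-- The marginal running cost `ā` of the conditional variance. -/
def aBar : ℝ := M.a3 - M.a2 * (2 * M.lam + M.delta)

/-- `L_v = ā / δ`. -/
def Lv : ℝ := M.aBar / M.delta

/-- `M₀ = γ_max² L_v`. -/
def M0 : ℝ := M.gammaMax ^ 2 * M.Lv

/-- The marginal information cost `c'` on `[0, ∞)` (one-sided derivative at `0`). -/
def cDeriv (x : ℝ) : ℝ := derivWithin M.c (Ici 0) x

/-- `h_max = (c')⁻¹(M₀)`, the inverse being that of `c'` on `[0, ∞)`.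
It is meaningful if `M₀` lies in the range of `c'`; `c'` is injective. -/
def hMax : ℝ := Function.invFunOn M.cDeriv (Ici 0) M.M0

/-- Admissible information acquisition rates: Borel functions `[0, ∞) → [0, h_max]`
(represented by Borel functions on `ℝ` whose values at negative times are irrelevant). -/
def Admissible (h : ℝ → ℝ) : Prop :=
  Measurable h ∧ ∀ t, 0 ≤ t → h t ∈ Icc 0 M.hMax

/-- `g` is the (Carathéodory, i.e. absolutely continuous) solution on `[0, ∞)` of
`dγ = f(γ, h) dt`, `γ(0) = g0`, written in integrated form. -/
def IsState (h : ℝ → ℝ) (g0 : ℝ) (g : ℝ → ℝ) : Prop :=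
  ContinuousOn g (Ici 0) ∧ ∀ t, 0 ≤ t → g t = g0 + ∫ s in (0 : ℝ)..t, M.f (g s) (h s)

/-- Running cost `k(γ, h) = ā γ + c(h)`. -/
def k (g h : ℝ) : ℝ := M.aBar * g + M.c h

/-- Discounted cost of the control `h` along the state trajectory `g`. -/
def cost (h g : ℝ → ℝ) : ℝ :=
  ∫ t in Ioi (0 : ℝ), Real.exp (-M.delta * t) * M.k (g t) (h t)

/-- Value function of the reduced problem: infimum of the cost over all admissible controls `h`,
the state being the trajectory driven by `h` and started at `g0`. -/
def v (g0 : ℝ) : ℝ :=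
  sInf {J | ∃ h g : ℝ → ℝ, M.Admissible h ∧ M.IsState h g0 g ∧ J = M.cost h g}

end Model

end InfoControl

end

/-! Fix one control and vary only the initial value: the information cost is then unchanged, so
everything reduces to how solutions of the Riccati equation depend on their start. A difference of
two solutions solves `d' = -r d` with `r ≤ maxRate`, so it keeps its sign, never grows on
nonnegative states, and is at least `(y - x) exp(-maxRate t)`. Discounting gives monotonicity and
the constant `ā/δ`. Since `f` is strictly concave in the state, the defect from linearity obeys a
linear equation with source at least a positive multiple of `exp(-2 maxRate t)`, which gives
concavity.

An infimum may destroy strict inequalities, so each gap is bounded below uniformly in the control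
(`exp_mul_le_sub`, `concave_gap`). Transferring a control to another start requires a state there;
`exists_isState` builds it explicitly from a known one. -/

open Set MeasureTheory

/-! ### Absolutely continuous functions and linear differential inequalities -/

noncomputable section
open Filter Topology

/-- `u` is absolutely continuous on `[0, T]`, with derivative `p` almost everywhere. -/
def HasACDeriv (u p : ℝ → ℝ) (T : ℝ) : Prop :=
  AbsolutelyContinuousOnInterval u 0 T ∧ ∀ᵐ t, t ∈ Ioo 0 T → HasDerivAt u (p t) t

/-- Postcomposition with a Lipschitz function preserves absolute continuity. -/
theorem AbsolutelyContinuousOnInterval.lipschitz_comp {u φ : ℝ → ℝ} {a b : ℝ} {K : NNReal}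
    (hu : AbsolutelyContinuousOnInterval u a b) (hφ : LipschitzOnWith K φ (u '' uIcc a b)) :
    AbsolutelyContinuousOnInterval (fun t => φ (u t)) a b := by
  unfold AbsolutelyContinuousOnInterval at hu ⊢
  have h0 := hu.const_mul (K : ℝ)
  rw [mul_zero] at h0
  refine squeeze_zero' (Eventually.of_forall fun E => Finset.sum_nonneg fun _ _ => dist_nonneg)
    ?_ h0
  have : ∀ᶠ E in totalLengthFilter ⊓ 𝓟 (disjWithin a b), E ∈ disjWithin a b :=
    mem_inf_of_right (mem_principal_self _)
  filter_upwards [this] with E hE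
  rw [Finset.mul_sum]
  exact Finset.sum_le_sum fun i hi =>
    hφ.dist_le_mul _ (mem_image_of_mem _ (hE.1 i hi).1) _ (mem_image_of_mem _ (hE.1 i hi).2)

namespace HasACDeriv

variable {u w p q : ℝ → ℝ} {T : ℝ}

theorem continuousOn (hu : HasACDeriv u p T) (hT : 0 ≤ T) : ContinuousOn u (Icc 0 T) := by
  have := hu.1.continuousOn
  rwa [uIcc_of_le hT] at this

theorem congr_deriv (hu : HasACDeriv u p T) (h : ∀ t ∈ Ioo 0 T, p t = q t) :
    HasACDeriv u q T := by
  refine ⟨hu.1, ?_⟩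
  filter_upwards [hu.2] with t ht hts
  rw [← h t hts]
  exact ht hts

theorem add (hu : HasACDeriv u p T) (hw : HasACDeriv w q T) :
    HasACDeriv (fun t => u t + w t) (fun t => p t + q t) T := by
  refine ⟨hu.1.add hw.1, ?_⟩
  filter_upwards [hu.2, hw.2] with t h1 h2 ht using (h1 ht).add (h2 ht)

theorem sub (hu : HasACDeriv u p T) (hw : HasACDeriv w q T) :
    HasACDeriv (fun t => u t - w t) (fun t => p t - q t) T := by
  refine ⟨hu.1.sub hw.1, ?_⟩
  filter_upwards [hu.2, hw.2] with t h1 h2 ht using (h1 ht).sub (h2 ht)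

theorem const_mul (c : ℝ) (hu : HasACDeriv u p T) :
    HasACDeriv (fun t => c * u t) (fun t => c * p t) T := by
  refine ⟨hu.1.const_mul c, ?_⟩
  filter_upwards [hu.2] with t h1 ht using (h1 ht).const_mul c

theorem mul (hu : HasACDeriv u p T) (hw : HasACDeriv w q T) :
    HasACDeriv (fun t => u t * w t) (fun t => p t * w t + u t * q t) T := by
  refine ⟨hu.1.mul hw.1, ?_⟩
  filter_upwards [hu.2, hw.2] with t h1 h2 ht using (h1 ht).mul (h2 ht)

theorem of_hasDerivAt (h : ∀ t, HasDerivAt u (p t) t) (hp : Continuous p) :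
    HasACDeriv u p T := by
  refine ⟨ContDiffOn.absolutelyContinuousOnInterval (ContDiff.contDiffOn ?_),
    Eventually.of_forall fun t _ => h t⟩
  have hd : deriv u = p := funext fun t => (h t).deriv
  rw [contDiff_one_iff_deriv, hd]
  exact ⟨fun t => (h t).differentiableAt, hp⟩

theorem const (c : ℝ) : HasACDeriv (fun _ => c) (fun _ => 0) T :=
  of_hasDerivAt (fun t => hasDerivAt_const t c) continuous_const

theorem integral_eq (hu : HasACDeriv u p T) (hT : 0 ≤ T) :
    ∫ s in (0 : ℝ)..T, p s = u T - u 0 := by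
  rw [← hu.1.integral_deriv_eq_sub]
  refine intervalIntegral.integral_congr_ae ?_
  have hne : ∀ᵐ t : ℝ, t ≠ T := by simp [ae_iff, measure_singleton]
  filter_upwards [hu.2, hne] with t h1 h2 ht
  rw [uIoc_of_le hT] at ht
  exact (h1 ⟨ht.1, lt_of_le_of_ne ht.2 h2⟩).deriv.symm

/-- On a compact convex set `φ'` is bounded, hence `φ` is Lipschitz there. -/
theorem comp (hu : HasACDeriv u p T) (hT : 0 ≤ T) {φ φ' : ℝ → ℝ} {s : Set ℝ} (hs : Convex ℝ s)
    (hsc : IsCompact s) (hus : ∀ t ∈ Icc 0 T, u t ∈ s) (hφ : ∀ x ∈ s, HasDerivAt φ (φ' x) x)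
    (hφ' : ContinuousOn φ' s) :
    HasACDeriv (fun t => φ (u t)) (fun t => φ' (u t) * p t) T := by
  obtain ⟨C, hC⟩ := hsc.exists_bound_of_continuousOn hφ'
  have hlip : LipschitzOnWith (Real.toNNReal C) φ s := by
    refine hs.lipschitzOnWith_of_nnnorm_hasDerivWithin_le
      (fun x hx => (hφ x hx).hasDerivWithinAt) fun x hx => ?_
    rw [← NNReal.coe_le_coe, coe_nnnorm]
    exact (hC x hx).trans (Real.le_coe_toNNReal C)
  refine ⟨hu.1.lipschitz_comp (hlip.mono ?_), ?_⟩
  · rw [uIcc_of_le hT]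
    rintro _ ⟨t, ht, rfl⟩
    exact hus t ht
  · filter_upwards [hu.2] with t h1 ht
    exact (hφ _ (hus t (Ioo_subset_Icc_self ht))).comp t (h1 ht)

theorem exp (hu : HasACDeriv u p T) (hT : 0 ≤ T) :
    HasACDeriv (fun t => Real.exp (u t)) (fun t => Real.exp (u t) * p t) T := by
  obtain ⟨C, hC⟩ := isCompact_Icc.exists_bound_of_continuousOn (hu.continuousOn hT)
  exact hu.comp hT (convex_Icc (-C) C) isCompact_Icc (fun t ht => abs_le.1 (hC t ht))
    (fun x _ => Real.hasDerivAt_exp x) Real.continuous_exp.continuousOn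

theorem inv (hu : HasACDeriv u p T) (hT : 0 ≤ T) (hpos : ∀ t ∈ Icc 0 T, 0 < u t) :
    HasACDeriv (fun t => (u t)⁻¹) (fun t => -((u t) ^ 2)⁻¹ * p t) T := by
  obtain ⟨C, hC⟩ := isCompact_Icc.exists_bound_of_continuousOn (hu.continuousOn hT)
  obtain ⟨τ, hτ, hmin⟩ :=
    isCompact_Icc.exists_isMinOn (nonempty_Icc.2 hT) (hu.continuousOn hT)
  have hx : ∀ x ∈ Icc (u τ) C, x ≠ 0 := fun x hx => ((hpos τ hτ).trans_le hx.1).ne'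
  refine hu.comp hT (φ := fun x => x⁻¹) (φ' := fun x => -(x ^ 2)⁻¹) (convex_Icc (u τ) C)
    isCompact_Icc (fun t ht => ⟨hmin ht, (abs_le.1 (hC t ht)).2⟩) (fun x h => hasDerivAt_inv (hx x h)) ?_
  exact ((continuousOn_id.pow 2).inv₀ fun x h => pow_ne_zero 2 (hx x h)).neg

theorem of_integral {c : ℝ} (hp : IntervalIntegrable p volume 0 T) (hT : 0 ≤ T)
    (hu : ∀ t ∈ Icc 0 T, u t = c + ∫ s in (0 : ℝ)..t, p s) : HasACDeriv u p T := by
  have hac : AbsolutelyContinuousOnInterval (fun t => c + ∫ s in (0 : ℝ)..t, p s) 0 T :=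
    (HasACDeriv.const c).1.add (hp.absolutelyContinuousOnInterval_intervalIntegral (by simp))
  refine ⟨?_, ?_⟩
  -- `u` agrees with the integral only on `[0, T]`, which contains all intervals tested by absolute
  -- continuity.
  · unfold AbsolutelyContinuousOnInterval at hac ⊢
    refine hac.congr' ?_
    have : ∀ᶠ E in AbsolutelyContinuousOnInterval.totalLengthFilter ⊓
        𝓟 (AbsolutelyContinuousOnInterval.disjWithin 0 T),
        E ∈ AbsolutelyContinuousOnInterval.disjWithin 0 T :=
      mem_inf_of_right (mem_principal_self _)
    filter_upwards [this] with E hE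
    refine Finset.sum_congr rfl fun i hi => ?_
    have := hE.1 i hi
    rw [uIcc_of_le hT] at this
    rw [hu _ this.1, hu _ this.2]
  · filter_upwards [hp.ae_hasDerivAt_integral] with t h1 ht
    have ht' : t ∈ uIcc 0 T := by
      rw [uIcc_of_le hT]
      exact Ioo_subset_Icc_self ht
    refine ((h1 ht' 0 (by simp)).const_add c).congr_of_eventuallyEq ?_
    filter_upwards [isOpen_Ioo.mem_nhds ht] with s hs using hu s (Ioo_subset_Icc_self hs)

theorem le_of_deriv_nonneg (hu : HasACDeriv u p T) (hT : 0 ≤ T) (hp : ∀ t ∈ Ioo 0 T, 0 ≤ p t) :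
    u 0 ≤ u T := by
  rw [← sub_nonneg, ← hu.integral_eq hT, intervalIntegral.integral_of_le hT,
    integral_Ioc_eq_integral_Ioo]
  exact setIntegral_nonneg measurableSet_Ioo hp

/-- Integrating factor: if `u' + b u ≥ 0`, then `u exp (∫ b)` does not decrease. -/
theorem le_mul_exp_integral (hu : HasACDeriv u p T) (hT : 0 ≤ T) {b : ℝ → ℝ}
    (hb : IntervalIntegrable b volume 0 T) (h : ∀ t ∈ Ioo 0 T, 0 ≤ p t + b t * u t) :
    u 0 ≤ u T * Real.exp (∫ s in (0 : ℝ)..T, b s) := by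
  have hB : HasACDeriv (fun t => ∫ s in (0 : ℝ)..t, b s) b T :=
    of_integral hb hT (c := 0) fun t _ => by rw [zero_add]
  have := (hu.mul (hB.exp hT)).le_of_deriv_nonneg hT fun t ht => by
    have := mul_nonneg (h t ht) (Real.exp_pos (∫ s in (0 : ℝ)..t, b s)).le
    linarith
  simpa using this

/-- The comparison principle behind all state estimates. No sign of `b` is needed, so `b` may itself
depend on the solutions compared. -/
theorem nonneg_of_linear (hu : HasACDeriv u p T) (hT : 0 ≤ T) {b : ℝ → ℝ}
    (hb : IntervalIntegrable b volume 0 T) (h0 : 0 ≤ u 0)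
    (h : ∀ t ∈ Ioo 0 T, 0 ≤ p t + b t * u t) : 0 ≤ u T :=
  nonneg_of_mul_nonneg_left (h0.trans (hu.le_mul_exp_integral hT hb h)) (Real.exp_pos _)

theorem pos_of_linear (hu : HasACDeriv u p T) (hT : 0 ≤ T) {b : ℝ → ℝ}
    (hb : IntervalIntegrable b volume 0 T) (h0 : 0 < u 0)
    (h : ∀ t ∈ Ioo 0 T, 0 ≤ p t + b t * u t) : 0 < u T :=
  pos_of_mul_pos_left (h0.trans_le (hu.le_mul_exp_integral hT hb h)) (Real.exp_pos _).le

end HasACDeriv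
end

/-! ### Signs of the constants and the uncontrolled equilibrium -/

noncomputable section

namespace InfoControl
namespace Model

variable {M : Model} {h g g₁ g₂ : ℝ → ℝ} {x y z T : ℝ}

/-- The rate `1/σ₁² + h` at which the variance is reduced by observation. -/
def gain (M : Model) (r : ℝ) : ℝ := (1 / M.sigma1) ^ 2 + r

theorem gain_le {r : ℝ} (hr : r ≤ M.hMax) : M.gain r ≤ M.gain M.hMax :=
  add_le_add_right hr _

theorem inv_sq_sigma1_pos : 0 < (1 / M.sigma1) ^ 2 :=
  pow_pos (one_div_pos.2 M.sigma1_pos) 2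

theorem gain_nonneg {r : ℝ} (hr : 0 ≤ r) : 0 ≤ M.gain r :=
  add_nonneg inv_sq_sigma1_pos.le hr

theorem f_eq (g r : ℝ) : M.f g r = -M.gain r * g ^ 2 - 2 * M.lam * g + M.sigma2 ^ 2 := rfl

theorem a1_pos : 0 < M.a1 := by
  have h1 : M.delta * M.rho <
      Real.sqrt (M.delta ^ 2 * M.rho ^ 2 + 4 * M.kappa * M.rho) := by
    apply Real.lt_sqrt_of_sq_lt
    have := mul_pos M.kappa_pos M.rho_pos
    nlinarith
  unfold a1
  linarith

theorem aBar_pos : 0 < M.aBar := by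
  have h1 := M.a1_pos
  have hr := M.rho_pos
  have hd := M.delta_pos
  have hl := M.lam_nonneg
  have h3 : 0 < M.a3 := by
    unfold a3
    have := mul_pos hd hr
    have := mul_nonneg hl hr.le
    positivity
  have h2 : M.aBar = M.a3 ^ 2 / (2 * M.rho) := by
    have : 2 * M.lam + M.delta ≠ 0 := by positivity
    unfold aBar a2
    field_simp
    ring
  rw [h2]
  positivity

/-- Without the range assumption `Function.invFunOn` returns an arbitrary value. Later arguments use
only this sign, which makes the zero control admissible. -/
theorem hMax_nonneg (hM0 : M.M0 ∈ M.cDeriv '' Ici 0) : 0 ≤ M.hMax :=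
  Function.invFunOn_mem hM0

/-- The stable equilibrium of the uncontrolled conditional variance. -/
def equilibrium (M : Model) : ℝ :=
  -M.lam * M.sigma1 ^ 2 + Real.sqrt (M.lam ^ 2 * M.sigma1 ^ 4 + M.sigma1 ^ 2 * M.sigma2 ^ 2)

theorem equilibrium_nonneg : 0 ≤ M.equilibrium := by
  have : M.lam * M.sigma1 ^ 2 ≤
      Real.sqrt (M.lam ^ 2 * M.sigma1 ^ 4 + M.sigma1 ^ 2 * M.sigma2 ^ 2) := by
    apply Real.le_sqrt_of_sq_le
    nlinarith [mul_nonneg (sq_nonneg M.sigma1) (sq_nonneg M.sigma2)]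
  unfold equilibrium
  linarith

theorem gammaMax_pos : 0 < M.gammaMax := equilibrium_nonneg.trans_lt M.gammaMax_gt

theorem f_equilibrium : M.f M.equilibrium 0 = 0 := by
  have hs : M.sigma1 ≠ 0 := M.sigma1_pos.ne'
  have h1 := Real.sq_sqrt (show 0 ≤ M.lam ^ 2 * M.sigma1 ^ 4 + M.sigma1 ^ 2 * M.sigma2 ^ 2 by
    positivity)
  have h2 : (M.equilibrium + M.lam * M.sigma1 ^ 2) ^ 2 =
      M.lam ^ 2 * M.sigma1 ^ 4 + M.sigma1 ^ 2 * M.sigma2 ^ 2 := by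
    rw [← h1]
    unfold equilibrium
    ring
  unfold f
  field_simp
  linear_combination -h2

theorem f_gammaMax_le {r : ℝ} (hr : 0 ≤ r) : M.f M.gammaMax r ≤ 0 := by
  have h1 := M.f_equilibrium
  have h2 : M.equilibrium < M.gammaMax := M.gammaMax_gt
  have h3 := M.equilibrium_nonneg
  unfold f at h1 ⊢
  have := M.inv_sq_sigma1_pos
  have := M.lam_nonneg
  have h4 : M.equilibrium ^ 2 ≤ M.gammaMax ^ 2 := by gcongr
  have h5 : (1 / M.sigma1) ^ 2 * M.equilibrium ^ 2 ≤ (1 / M.sigma1) ^ 2 * M.gammaMax ^ 2 := by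
    gcongr
  have h6 := mul_le_mul_of_nonneg_left h2.le M.lam_nonneg
  have h7 := mul_nonneg hr (sq_nonneg M.gammaMax)
  linarith

/-! ### Admissible controls, states and comparison estimates -/

theorem Admissible.nonneg (hh : M.Admissible h) {t : ℝ} (ht : 0 ≤ t) : 0 ≤ h t := (hh.2 t ht).1

theorem Admissible.le (hh : M.Admissible h) {t : ℝ} (ht : 0 ≤ t) : h t ≤ M.hMax := (hh.2 t ht).2

theorem Admissible.intervalIntegrable_gain (hh : M.Admissible h) (hT : 0 ≤ T) :
    IntervalIntegrable (fun t => M.gain (h t)) volume 0 T := by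
  refine IntervalIntegrable.add intervalIntegrable_const ?_
  rw [intervalIntegrable_iff_integrableOn_Ioc_of_le hT]
  refine Measure.integrableOn_of_bounded (M := M.hMax) (by simp) hh.1.aestronglyMeasurable ?_
  filter_upwards [ae_restrict_mem measurableSet_Ioc] with t ht
  rw [Real.norm_of_nonneg (hh.nonneg ht.1.le)]
  exact hh.le ht.1.le

theorem Admissible.intervalIntegrable_gain_mul (hh : M.Admissible h) (hT : 0 ≤ T)
    {u : ℝ → ℝ} (hu : ContinuousOn u (Icc 0 T)) :
    IntervalIntegrable (fun t => M.gain (h t) * u t) volume 0 T :=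
  (hh.intervalIntegrable_gain hT).mul_continuousOn (by rwa [uIcc_of_le hT])

/-- The linear decay rate of the difference of two states with sum `u`. -/
theorem Admissible.intervalIntegrable_rate (hh : M.Admissible h) (hT : 0 ≤ T)
    {u : ℝ → ℝ} (hu : ContinuousOn u (Icc 0 T)) :
    IntervalIntegrable (fun t => M.gain (h t) * u t + 2 * M.lam) volume 0 T :=
  (hh.intervalIntegrable_gain_mul hT hu).add intervalIntegrable_const

theorem IsState.continuousOn_Icc (hg : M.IsState h x g) : ContinuousOn g (Icc 0 T) :=
  hg.1.mono Icc_subset_Ici_self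

theorem IsState.apply_zero (hg : M.IsState h x g) : g 0 = x := by
  simpa using hg.2 0 le_rfl

theorem IsState.hasACDeriv (hh : M.Admissible h) (hg : M.IsState h x g) (hT : 0 ≤ T) :
    HasACDeriv g (fun t => M.f (g t) (h t)) T := by
  refine HasACDeriv.of_integral (c := x) ?_ hT fun t ht => hg.2 t ht.1
  have hc : ContinuousOn g (Icc 0 T) := hg.continuousOn_Icc
  have h1 := hh.intervalIntegrable_gain_mul hT (hc.pow 2)
  have h2 : IntervalIntegrable (fun t => M.sigma2 ^ 2 - 2 * M.lam * g t) volume 0 T := by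
    apply ContinuousOn.intervalIntegrable
    rw [uIcc_of_le hT]
    exact continuousOn_const.sub (continuousOn_const.mul hc)
  refine (h2.sub h1).congr fun t _ => ?_
  simp only [f_eq, Pi.pow_apply]
  ring

theorem isState_of_hasACDeriv (h0 : g 0 = x)
    (hg : ∀ T, 0 ≤ T → HasACDeriv g (fun t => M.f (g t) (h t)) T) : M.IsState h x g := by
  refine ⟨fun t ht => ?_, fun t ht => ?_⟩
  · have h1 := (hg (t + 1) (add_nonneg ht zero_le_one)).continuousOn
      (add_nonneg ht zero_le_one) t ⟨ht, by linarith⟩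
    refine h1.mono_of_mem_nhdsWithin ?_
    rw [← Ici_inter_Iic]
    exact Filter.inter_mem self_mem_nhdsWithin
      (mem_nhdsWithin_of_mem_nhds (Iic_mem_nhds (by linarith)))
  · rw [(hg t ht).integral_eq ht, h0]
    ring

theorem IsState.nonneg (hh : M.Admissible h) (hg : M.IsState h x g) (hx : 0 ≤ x)
    (hT : 0 ≤ T) : 0 ≤ g T := by
  -- With rate `gain * g + 2λ` the left side of the inequality is exactly `σ₂²`.
  refine (hg.hasACDeriv hh hT).nonneg_of_linear hT
    (hh.intervalIntegrable_rate hT hg.continuousOn_Icc) (by rwa [hg.apply_zero]) fun t _ => ?_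
  rw [f_eq]
  nlinarith [sq_nonneg M.sigma2]

theorem IsState.le_gammaMax (hh : M.Admissible h) (hg : M.IsState h x g) (hx : x ≤ M.gammaMax)
    (hT : 0 ≤ T) : g T ≤ M.gammaMax := by
  rw [← sub_nonneg]
  -- For `γ_max - g` and rate `gain * (γ_max + g) + 2λ`, the left side is `-f(γ_max, h)`.
  refine ((HasACDeriv.const M.gammaMax).sub (hg.hasACDeriv hh hT)).nonneg_of_linear hT
    (hh.intervalIntegrable_rate hT
      ((continuousOn_const (c := M.gammaMax)).fun_add hg.continuousOn_Icc))
    (by rw [hg.apply_zero]; linarith) fun t ht => ?_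
  have := M.f_gammaMax_le (hh.nonneg ht.1.le)
  simp only [f_eq] at this ⊢
  linarith

theorem IsState.le_of_le (hh : M.Admissible h) (h₁ : M.IsState h x g₁) (h₂ : M.IsState h y g₂)
    (hxy : x ≤ y) (hT : 0 ≤ T) : g₁ T ≤ g₂ T := by
  rw [← sub_nonneg]
  refine ((h₂.hasACDeriv hh hT).sub (h₁.hasACDeriv hh hT)).nonneg_of_linear hT
    (hh.intervalIntegrable_rate hT (h₂.continuousOn_Icc.fun_add h₁.continuousOn_Icc))
    (by rw [h₁.apply_zero, h₂.apply_zero]; linarith) fun t _ => ?_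
  simp only [f_eq]
  apply le_of_eq
  ring

theorem IsState.sub_le (hh : M.Admissible h) (h₁ : M.IsState h x g₁) (h₂ : M.IsState h y g₂)
    (hx : 0 ≤ x) (hxy : x ≤ y) (hT : 0 ≤ T) : g₂ T - g₁ T ≤ y - x := by
  have := ((h₁.hasACDeriv hh hT).sub (h₂.hasACDeriv hh hT)).le_of_deriv_nonneg hT fun t ht => by
    have h3 := h₁.le_of_le hh h₂ hxy ht.1.le
    have h4 := h₁.nonneg hh hx ht.1.le
    have h5 : g₁ t ^ 2 ≤ g₂ t ^ 2 := by gcongr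
    have h6 := mul_le_mul_of_nonneg_left h5 (M.gain_nonneg (hh.nonneg ht.1.le))
    have h7 := mul_le_mul_of_nonneg_left h3 M.lam_nonneg
    simp only [f_eq]
    linarith
  rw [h₁.apply_zero, h₂.apply_zero] at this
  linarith

/-- A bound for the linear decay rate of the difference of two states. -/
def maxRate (M : Model) : ℝ := M.gain M.hMax * (2 * M.gammaMax) + 2 * M.lam

theorem rate_le_maxRate {r s : ℝ} (hr : r ∈ Icc 0 M.hMax) (hs : s ≤ 2 * M.gammaMax) :
    M.gain r * s + 2 * M.lam ≤ M.maxRate := by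
  have h1 := mul_le_mul_of_nonneg_left hs (M.gain_nonneg hr.1)
  have h2 := mul_le_mul_of_nonneg_right (M.gain_le hr.2)
    (mul_nonneg zero_le_two M.gammaMax_pos.le)
  unfold maxRate
  linarith

theorem maxRate_nonneg (h0 : 0 ≤ M.hMax) : 0 ≤ M.maxRate := by
  have h1 := M.gain_nonneg h0
  have h2 := M.gammaMax_pos
  have h3 := M.lam_nonneg
  unfold maxRate
  positivity

theorem hasDerivAt_const_mul_exp (a r t : ℝ) :
    HasDerivAt (fun s => a * Real.exp (r * s)) (a * (Real.exp (r * t) * r)) t :=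
  (((hasDerivAt_id t).const_mul r).exp.const_mul a).congr_deriv (by simp)

theorem hasACDeriv_const_mul_exp (a r : ℝ) :
    HasACDeriv (fun s => a * Real.exp (r * s)) (fun t => a * (Real.exp (r * t) * r)) T :=
  HasACDeriv.of_hasDerivAt (hasDerivAt_const_mul_exp a r) (by fun_prop)

theorem IsState.exp_mul_le_sub (hh : M.Admissible h) (h₁ : M.IsState h x g₁)
    (h₂ : M.IsState h y g₂) (hxy : x ≤ y) (hy : y ≤ M.gammaMax) (hT : 0 ≤ T) :
    (y - x) * Real.exp (-M.maxRate * T) ≤ g₂ T - g₁ T := by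
  rw [← sub_nonneg]
  refine (((h₂.hasACDeriv hh hT).sub (h₁.hasACDeriv hh hT)).sub
    (hasACDeriv_const_mul_exp (y - x) (-M.maxRate))).nonneg_of_linear hT
    (hh.intervalIntegrable_rate hT (h₂.continuousOn_Icc.fun_add h₁.continuousOn_Icc))
    (by rw [h₁.apply_zero, h₂.apply_zero]; simp) fun t ht => ?_
  have h3 := rate_le_maxRate (hh.2 t ht.1.le)
    (show g₂ t + g₁ t ≤ 2 * M.gammaMax by
      linarith [h₁.le_gammaMax hh (hxy.trans hy) ht.1.le, h₂.le_gammaMax hh hy ht.1.le])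
  have h4 := mul_le_mul_of_nonneg_right h3
    (mul_nonneg (sub_nonneg.2 hxy) (Real.exp_pos (-M.maxRate * t)).le)
  simp only [f_eq]
  linarith

/-- With `m = a g₁ + b g₂`, the defect `d = g - m` satisfies `d' + (gain (g + m) + 2λ) d = gain a b
(g₂ - g₁)²`. The left side of the claim is a subsolution `φ`, chosen to vanish at `0`: with `K =
maxRate`, `φ' + 2Kφ = W exp(-(2K+1)t)`, which is below the source. -/
theorem IsState.concave_gap (hh : M.Admissible h) {a b : ℝ} (ha : 0 ≤ a) (hb : 0 ≤ b)
    (hab : a + b = 1) (h₁ : M.IsState h x g₁) (h₂ : M.IsState h y g₂)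
    (hg : M.IsState h (a * x + b * y) g) (hxy : x ≤ y) (hy : y ≤ M.gammaMax) (hT : 0 ≤ T) :
    (1 / M.sigma1) ^ 2 * a * b * (y - x) ^ 2 *
      (Real.exp (-(2 * M.maxRate) * T) - Real.exp (-(2 * M.maxRate + 1) * T)) ≤
      g T - (a * g₁ T + b * g₂ T) := by
  set W := (1 / M.sigma1) ^ 2 * a * b * (y - x) ^ 2 with hW
  have hs := M.inv_sq_sigma1_pos
  have hW0 : 0 ≤ W := by positivity
  have hK := maxRate_nonneg ((hh.nonneg le_rfl).trans (hh.le le_rfl))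
  rw [← sub_nonneg, mul_sub]
  have hx := hxy.trans hy
  have hz : a * x + b * y ≤ M.gammaMax := by
    have := mul_le_mul_of_nonneg_left hx ha
    have := mul_le_mul_of_nonneg_left hy hb
    have : a * M.gammaMax + b * M.gammaMax = M.gammaMax := by rw [← add_mul, hab, one_mul]
    linarith
  have hc₁ : ContinuousOn g₁ (Icc 0 T) := h₁.continuousOn_Icc
  have hc₂ : ContinuousOn g₂ (Icc 0 T) := h₂.continuousOn_Icc
  refine (((hg.hasACDeriv hh hT).sub (((h₁.hasACDeriv hh hT).const_mul a).add
    ((h₂.hasACDeriv hh hT).const_mul b))).sub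
    ((hasACDeriv_const_mul_exp W (-(2 * M.maxRate))).sub
      (hasACDeriv_const_mul_exp W (-(2 * M.maxRate + 1))))).nonneg_of_linear hT
    (hh.intervalIntegrable_rate hT (hg.continuousOn_Icc.fun_add
      (((continuousOn_const (c := a)).fun_mul hc₁).fun_add
        ((continuousOn_const (c := b)).fun_mul hc₂))))
    (by rw [h₁.apply_zero, h₂.apply_zero, hg.apply_zero]; simp) fun t ht => ?_
  have hb₁ := h₁.le_gammaMax hh hx ht.1.le
  have hb₂ := h₂.le_gammaMax hh hy ht.1.le
  have hbz := hg.le_gammaMax hh hz ht.1.le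
  have hm : a * g₁ t + b * g₂ t ≤ M.gammaMax := by
    have := mul_le_mul_of_nonneg_left hb₁ ha
    have := mul_le_mul_of_nonneg_left hb₂ hb
    have : a * M.gammaMax + b * M.gammaMax = M.gammaMax := by rw [← add_mul, hab, one_mul]
    linarith
  have hrate := rate_le_maxRate (hh.2 t ht.1.le)
    (show g t + (a * g₁ t + b * g₂ t) ≤ 2 * M.gammaMax by linarith)
  have hd := h₁.exp_mul_le_sub hh h₂ hxy hy ht.1.le
  have hd2 : (y - x) ^ 2 * Real.exp (-(2 * M.maxRate) * t) ≤ (g₂ t - g₁ t) ^ 2 := by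
    have he : Real.exp (-(2 * M.maxRate) * t) = Real.exp (-M.maxRate * t) ^ 2 := by
      rw [← Real.exp_nat_mul]
      congr 1
      push_cast
      ring
    rw [he, ← mul_pow]
    have := mul_nonneg (sub_nonneg.2 hxy) (Real.exp_pos (-M.maxRate * t)).le
    gcongr
  have hsrc : W * Real.exp (-(2 * M.maxRate) * t) ≤
      M.gain (h t) * (a * b * (g₂ t - g₁ t) ^ 2) := by
    have e1 : (1 / M.sigma1) ^ 2 ≤ M.gain (h t) := le_add_of_nonneg_right (hh.nonneg ht.1.le)
    have e2 := hs.le.trans e1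
    calc W * Real.exp (-(2 * M.maxRate) * t)
        = (1 / M.sigma1) ^ 2 * (a * b * ((y - x) ^ 2 * Real.exp (-(2 * M.maxRate) * t))) := by
          rw [hW]; ring
      _ ≤ M.gain (h t) * (a * b * (g₂ t - g₁ t) ^ 2) := by gcongr
  have hE : Real.exp (-(2 * M.maxRate + 1) * t) ≤ Real.exp (-(2 * M.maxRate) * t) :=
    Real.exp_le_exp.2 (by nlinarith [ht.1])
  have hφ := mul_nonneg (sub_nonneg.2 (hrate.trans (by linarith : M.maxRate ≤ 2 * M.maxRate)))
    (mul_nonneg hW0 (sub_nonneg.2 hE))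
  have hb' : b = 1 - a := by linarith
  simp only [f_eq]
  set E₁ := Real.exp (-(2 * M.maxRate) * t)
  set E₂ := Real.exp (-(2 * M.maxRate + 1) * t)
  -- The three nonnegative contributions: surplus of the source, surplus of `2 maxRate` over the
  -- true rate, and the gap between the two exponentials.
  have key : 0 ≤ M.gain (h t) * (a * b * (g₂ t - g₁ t) ^ 2) - W * E₁ +
      (2 * M.maxRate - (M.gain (h t) * (g t + (a * g₁ t + b * g₂ t)) + 2 * M.lam)) *
        (W * (E₁ - E₂)) + W * (E₁ - E₂) := by
    have := mul_nonneg hW0 (sub_nonneg.2 hE)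
    linarith
  clear_value W
  subst hb'
  refine key.trans (le_of_eq ?_)
  ring

/-! ### Solving the Riccati equation from every nonnegative start -/

/-- If the numerator and denominator of a state in projective coordinates solve the linear system
associated with the Riccati equation, then the denominator stays positive. -/
theorem denominator_pos (hh : M.Admissible h) (hg : M.IsState h z g) {N D : ℝ → ℝ}
    (hN0 : 0 ≤ N 0) (hD0 : 0 < D 0)
    (hN : ∀ T, 0 ≤ T → HasACDeriv N
      (fun t => M.sigma2 ^ 2 * D t - (M.gain (h t) * g t + 2 * M.lam) * N t) T)
    (hD : ∀ T, 0 ≤ T → HasACDeriv D (fun t => M.gain (h t) * (N t - g t * D t)) T)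
    (hT : 0 ≤ T) : 0 < D T := by
  by_contra! hneg
  have hclosed : IsCompact {t | t ∈ Icc 0 T ∧ D t ≤ 0} := by
    have := ((hD T hT).continuousOn hT).preimage_isClosed_of_isClosed isClosed_Icc
      (isClosed_Iic (a := (0 : ℝ)))
    exact isCompact_Icc.of_isClosed_subset this fun t ht => ht.1
  -- Up to the first time `τ` with `D ≤ 0`, positivity of `D` keeps `N ≥ 0`, and this in turn forces
  -- `D τ > 0`.
  obtain ⟨τ, ⟨hτ, hDτ⟩, hmin⟩ := hclosed.exists_isLeast ⟨T, ⟨hT, le_rfl⟩, hneg⟩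
  have hpos : ∀ t, 0 ≤ t → t < τ → 0 < D t := fun t h0 ht => by
    by_contra! hle
    exact absurd (hmin ⟨⟨h0, ht.le.trans hτ.2⟩, hle⟩) (not_le.2 ht)
  have hNpos : ∀ t ∈ Ioo 0 τ, 0 ≤ N t := fun t ht => by
    refine (hN t ht.1.le).nonneg_of_linear ht.1.le
      (hh.intervalIntegrable_rate ht.1.le hg.continuousOn_Icc) hN0 fun s hs => ?_
    have := mul_nonneg (sq_nonneg M.sigma2) (hpos s hs.1.le (hs.2.trans ht.2)).le
    linarith
  refine absurd hDτ (not_le.2 ?_)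
  refine (hD τ hτ.1).pos_of_linear hτ.1 (hh.intervalIntegrable_gain_mul hτ.1 hg.continuousOn_Icc)
    hD0 fun t ht => ?_
  have := mul_nonneg (M.gain_nonneg (hh.nonneg ht.1.le)) (hNpos t ht)
  linarith

/-- One solution of the Riccati equation yields solutions from all nonnegative initial
values. -/
theorem IsState.exists_isState (hh : M.Admissible h) (hg : M.IsState h z g) (hx : 0 ≤ x) :
    ∃ g', M.IsState h x g' := by
  -- The difference `w` from `g` solves the Bernoulli equation `w' = -R w - gain w²`, so `1/w` is
  -- linear and `w = (x - z) E / D`.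
  set R : ℝ → ℝ := fun t => M.gain (h t) * (2 * g t) + 2 * M.lam with hR
  have hRint : ∀ T, 0 ≤ T → IntervalIntegrable R volume 0 T := fun T hT =>
    hh.intervalIntegrable_rate hT ((continuousOn_const (c := (2 : ℝ))).fun_mul hg.continuousOn_Icc)
  set E : ℝ → ℝ := fun t => Real.exp (-1 * ∫ s in (0 : ℝ)..t, R s) with hEdef
  have hE : ∀ T, 0 ≤ T → HasACDeriv E (fun t => E t * (-1 * R t)) T := fun T hT =>
    ((HasACDeriv.of_integral (c := 0) (hRint T hT) hT
      fun t _ => by rw [zero_add]).const_mul (-1)).exp hT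
  have hE0 : E 0 = 1 := by simp [hEdef]
  set D : ℝ → ℝ := fun t => 1 + ∫ s in (0 : ℝ)..t, (x - z) * (M.gain (h s) * E s) with hDdef
  have hD : ∀ T, 0 ≤ T → HasACDeriv D (fun t => (x - z) * (M.gain (h t) * E t)) T :=
    fun T hT => HasACDeriv.of_integral (c := 1)
      ((hh.intervalIntegrable_gain_mul hT ((hE T hT).continuousOn hT)).const_mul (x - z)) hT
      fun t _ => rfl
  have hD0 : D 0 = 1 := by simp [hDdef]
  have hDpos : ∀ T, 0 ≤ T → 0 < D T := fun T hT => by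
    -- This `N` is the new state times `D`; it starts at `x ≥ 0`.
    refine denominator_pos hh hg (N := fun t => g t * D t + (x - z) * E t)
      (by rw [hg.apply_zero, hE0, hD0]; linarith) (by rw [hD0]; exact one_pos)
      (fun S hS => ?_) (fun S hS => ?_) hT
    · refine (((hg.hasACDeriv hh hS).mul (hD S hS)).add
        ((hE S hS).const_mul (x - z))).congr_deriv fun t _ => ?_
      simp only [f_eq, hR]
      ring
    · exact (hD S hS).congr_deriv fun t _ => by ring
  refine ⟨fun t => g t + (x - z) * (E t * (D t)⁻¹), isState_of_hasACDeriv ?_ fun T hT => ?_⟩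
  · rw [hg.apply_zero, hE0, hD0]
    ring
  · refine ((hg.hasACDeriv hh hT).add (((hE T hT).mul
      ((hD T hT).inv hT fun t ht => hDpos t ht.1)).const_mul (x - z))).congr_deriv fun t _ => ?_
    simp only [f_eq, hR, ← inv_pow]
    ring

theorem admissible_zero (h0 : 0 ≤ M.hMax) : M.Admissible fun _ => 0 :=
  ⟨measurable_const, fun _ _ => ⟨le_rfl, h0⟩⟩

theorem exists_admissible_isState (h0 : 0 ≤ M.hMax) (hx : 0 ≤ x) :
    ∃ h g, M.Admissible h ∧ M.IsState h x g := by
  have hg : M.IsState (fun _ => 0) M.equilibrium fun _ => M.equilibrium :=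
    ⟨continuousOn_const, fun t _ => by simp [f_equilibrium]⟩
  obtain ⟨g, hg'⟩ := hg.exists_isState (admissible_zero h0) hx
  exact ⟨_, g, admissible_zero h0, hg'⟩

/-! ### Discounted integrals and the cost -/

/-- The discounted integral of `u`. -/
def discounted (M : Model) (u : ℝ → ℝ) : ℝ := ∫ t in Ioi (0 : ℝ), Real.exp (-M.delta * t) * u t

/-- `u` has an absolutely convergent discounted integral. -/
def Discountable (M : Model) (u : ℝ → ℝ) : Prop :=
  IntegrableOn (fun t => Real.exp (-M.delta * t) * u t) (Ioi 0)

theorem discountable_of_bounded {u : ℝ → ℝ} {C : ℝ}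
    (hu : AEStronglyMeasurable u (volume.restrict (Ioi 0))) (hC : ∀ t, 0 < t → |u t| ≤ C) :
    M.Discountable u := by
  refine (exp_neg_integrableOn_Ioi 0 M.delta_pos).mul_bdd (c := C) hu ?_
  filter_upwards [ae_restrict_mem measurableSet_Ioi] with t ht using hC t ht

theorem Discountable.add {u w : ℝ → ℝ} (hu : M.Discountable u) (hw : M.Discountable w) :
    M.Discountable fun t => u t + w t := by
  refine (Integrable.add hu hw).congr (Filter.Eventually.of_forall fun t => ?_)
  simp only [Pi.add_apply]
  ring

theorem Discountable.const_mul {u : ℝ → ℝ} (hu : M.Discountable u) (a : ℝ) :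
    M.Discountable fun t => a * u t := by
  refine (Integrable.const_mul hu a).congr (Filter.Eventually.of_forall fun t => ?_)
  ring

theorem discounted_add {u w : ℝ → ℝ} (hu : M.Discountable u) (hw : M.Discountable w) :
    M.discounted (fun t => u t + w t) = M.discounted u + M.discounted w := by
  unfold discounted
  rw [← integral_add hu hw]
  simp only [mul_add]

theorem discounted_const_mul (a : ℝ) (u : ℝ → ℝ) :
    M.discounted (fun t => a * u t) = a * M.discounted u := by
  unfold discounted
  rw [← integral_const_mul]
  congr 1 with t
  ring

theorem discounted_mono {u w : ℝ → ℝ} (hu : M.Discountable u) (hw : M.Discountable w)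
    (huw : ∀ t, 0 ≤ t → u t ≤ w t) : M.discounted u ≤ M.discounted w :=
  setIntegral_mono_on hu hw measurableSet_Ioi fun t ht =>
    mul_le_mul_of_nonneg_left (huw t (mem_Ioi.1 ht).le) (Real.exp_pos _).le

theorem discountable_exp {r : ℝ} (hr : 0 ≤ r) : M.Discountable fun t => Real.exp (-r * t) := by
  refine discountable_of_bounded (C := 1) (by fun_prop) fun t ht => ?_
  rw [abs_of_pos (Real.exp_pos _), Real.exp_le_one_iff]
  nlinarith

theorem discounted_exp {r : ℝ} (hr : 0 ≤ r) :
    M.discounted (fun t => Real.exp (-r * t)) = 1 / (M.delta + r) := by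
  have hd := M.delta_pos
  have := integral_exp_mul_Ioi (a := -(M.delta + r)) (by linarith) 0
  rw [mul_zero, Real.exp_zero, neg_div_neg_eq] at this
  rw [← this]
  unfold discounted
  congr 1 with t
  rw [← Real.exp_add]
  ring_nf

theorem discounted_const (a : ℝ) : M.discounted (fun _ => a) = a / M.delta := by
  have := discounted_const_mul (M := M) a fun t => Real.exp (-0 * t)
  rw [discounted_exp le_rfl] at this
  simpa [div_eq_mul_inv] using this

theorem discountable_const (a : ℝ) : M.Discountable fun _ => a :=
  discountable_of_bounded (C := |a|) aestronglyMeasurable_const fun _ _ => le_rfl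

theorem IsState.discountable (hh : M.Admissible h) (hg : M.IsState h x g)
    (hx : x ∈ Icc 0 M.gammaMax) : M.Discountable g := by
  refine discountable_of_bounded (C := M.gammaMax)
    ((hg.1.mono Ioi_subset_Ici_self).aestronglyMeasurable measurableSet_Ioi) fun t ht => ?_
  rw [abs_of_nonneg (hg.nonneg hh hx.1 ht.le)]
  exact hg.le_gammaMax hh hx.2 ht.le

theorem Admissible.discountable_c (hh : M.Admissible h) : M.Discountable fun t => M.c (h t) := by
  -- `c` is controlled only on `[0, ∞)`; composing with `max 0` gives a globally continuous function
  -- for measurability.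
  have hc : Continuous fun r => M.c (max 0 r) :=
    M.c_contDiff.continuousOn.comp_continuous (by fun_prop) fun r => le_max_left 0 r
  refine discountable_of_bounded (C := M.c M.hMax) ?_ fun t ht => ?_
  · refine (hc.measurable.comp hh.1).aestronglyMeasurable.congr ?_
    filter_upwards [ae_restrict_mem measurableSet_Ioi] with t ht
    simp only [Function.comp_apply]
    rw [max_eq_right (hh.nonneg (mem_Ioi.1 ht).le)]
  · have h1 := hh.nonneg ht.le
    have h2 := hh.le ht.le
    rw [abs_of_nonneg (M.c_nonneg _ h1)]
    exact M.c_strictMono.monotoneOn h1 (h1.trans h2) h2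

theorem IsState.cost_eq (hh : M.Admissible h) (hg : M.IsState h x g)
    (hx : x ∈ Icc 0 M.gammaMax) :
    M.cost h g = M.aBar * M.discounted g + M.discounted fun t => M.c (h t) := by
  rw [← discounted_const_mul, ← discounted_add ((hg.discountable hh hx).const_mul _)
    hh.discountable_c]
  rfl

theorem IsState.cost_nonneg (hh : M.Admissible h) (hg : M.IsState h x g) (hx : 0 ≤ x) :
    0 ≤ M.cost h g :=
  setIntegral_nonneg measurableSet_Ioi fun _ ht => mul_nonneg (Real.exp_pos _).le
    (add_nonneg (mul_nonneg M.aBar_pos.le (hg.nonneg hh hx (mem_Ioi.1 ht).le))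
      (M.c_nonneg _ (hh.nonneg (mem_Ioi.1 ht).le)))

theorem IsState.v_le_cost (hh : M.Admissible h) (hg : M.IsState h x g) (hx : 0 ≤ x) :
    M.v x ≤ M.cost h g := by
  refine csInf_le ⟨0, ?_⟩ ⟨h, g, hh, hg, rfl⟩
  rintro _ ⟨h', g', hh', hg', rfl⟩
  exact hg'.cost_nonneg hh' hx

/-- Nonemptiness matters here, since `sInf ∅ = 0`. -/
theorem le_v (h0 : 0 ≤ M.hMax) (hx : 0 ≤ x) {C : ℝ}
    (hC : ∀ h g, M.Admissible h → M.IsState h x g → C ≤ M.cost h g) : C ≤ M.v x := by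
  obtain ⟨h, g, hh, hg⟩ := exists_admissible_isState h0 hx
  refine le_csInf ⟨_, h, g, hh, hg, rfl⟩ ?_
  rintro _ ⟨h', g', hh', hg', rfl⟩
  exact hC h' g' hh' hg'

/-! ### Regularity of the value function -/

theorem v_le_v_add (h0 : 0 ≤ M.hMax) (hx : 0 ≤ x) (hxy : x ≤ y) (hy : y ≤ M.gammaMax) :
    M.v y ≤ M.v x + M.Lv * (y - x) := by
  rw [← sub_le_iff_le_add]
  refine le_v h0 hx fun h g₁ hh h₁ => ?_
  obtain ⟨g₂, h₂⟩ := h₁.exists_isState hh (hx.trans hxy)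
  have hx' : x ∈ Icc 0 M.gammaMax := ⟨hx, hxy.trans hy⟩
  have hy' : y ∈ Icc 0 M.gammaMax := ⟨hx.trans hxy, hy⟩
  have hle := discounted_mono (h₂.discountable hh hy')
    ((h₁.discountable hh hx').add (discountable_const (y - x)))
    fun _ ht => by linarith [h₁.sub_le hh h₂ hx hxy ht]
  rw [discounted_add (h₁.discountable hh hx') (discountable_const _), discounted_const] at hle
  have hv := h₂.v_le_cost hh hy'.1
  rw [h₂.cost_eq hh hy'] at hv
  rw [h₁.cost_eq hh hx']
  have := mul_le_mul_of_nonneg_left hle M.aBar_pos.le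
  have hL : M.Lv * (y - x) = M.aBar * ((y - x) / M.delta) := by
    unfold Lv
    ring
  linarith

/-- The gap is the discounted integral of the exponential lower bound for the difference of states;
being independent of the control, it survives the infimum. -/
theorem v_add_le_v (h0 : 0 ≤ M.hMax) (hx : 0 ≤ x) (hxy : x ≤ y) (hy : y ≤ M.gammaMax) :
    M.v x + M.aBar * ((y - x) * (1 / (M.delta + M.maxRate))) ≤ M.v y := by
  have hK := maxRate_nonneg h0
  refine le_v h0 (hx.trans hxy) fun h g₂ hh h₂ => ?_
  obtain ⟨g₁, h₁⟩ := h₂.exists_isState hh hx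
  have hx' : x ∈ Icc 0 M.gammaMax := ⟨hx, hxy.trans hy⟩
  have hy' : y ∈ Icc 0 M.gammaMax := ⟨hx.trans hxy, hy⟩
  have hd := (discountable_exp (M := M) hK).const_mul (y - x)
  have hle := discounted_mono ((h₁.discountable hh hx').add hd) (h₂.discountable hh hy')
    fun t ht => by linarith [h₁.exp_mul_le_sub hh h₂ hxy hy ht]
  rw [discounted_add (h₁.discountable hh hx') hd, discounted_const_mul, discounted_exp hK] at hle
  have hv := h₁.v_le_cost hh hx
  rw [h₁.cost_eq hh hx'] at hv
  rw [h₂.cost_eq hh hy']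
  have := mul_le_mul_of_nonneg_left hle M.aBar_pos.le
  linarith

theorem v_concave_gap (h0 : 0 ≤ M.hMax) {a b : ℝ} (ha : 0 < a) (hb : 0 < b) (hab : a + b = 1)
    (hx : 0 ≤ x) (hxy : x < y) (hy : y ≤ M.gammaMax) :
    a * M.v x + b * M.v y < M.v (a * x + b * y) := by
  have hK := maxRate_nonneg h0
  have hd := M.delta_pos
  have hy0 : 0 ≤ y := hx.trans hxy.le
  have hx' : x ∈ Icc 0 M.gammaMax := ⟨hx, hxy.le.trans hy⟩
  have hy' : y ∈ Icc 0 M.gammaMax := ⟨hy0, hy⟩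
  have hz' : a * x + b * y ∈ Icc 0 M.gammaMax :=
    convex_Icc 0 M.gammaMax hx' hy' ha.le hb.le hab
  set W := (1 / M.sigma1) ^ 2 * a * b * (y - x) ^ 2
  -- `G` is the discounted integral of the difference of exponentials in `concave_gap`.
  set G := 1 / (M.delta + 2 * M.maxRate) + -1 * (1 / (M.delta + (2 * M.maxRate + 1)))
  have hG : 0 < G := by
    have : 1 / (M.delta + (2 * M.maxRate + 1)) < 1 / (M.delta + 2 * M.maxRate) :=
      one_div_lt_one_div_of_lt (by positivity) (by linarith)
    simp only [G]
    linarith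
  have hW : 0 < W := by
    have := M.inv_sq_sigma1_pos
    have := sub_pos.2 hxy
    positivity
  have hgap : 0 < M.aBar * (W * G) := mul_pos M.aBar_pos (mul_pos hW hG)
  refine lt_of_lt_of_le (lt_add_of_pos_right _ hgap) (le_v h0 hz'.1 fun h g hh hg => ?_)
  obtain ⟨g₁, h₁⟩ := hg.exists_isState hh hx
  obtain ⟨g₂, h₂⟩ := hg.exists_isState hh hy0
  have hd₁ := (h₁.discountable hh hx').const_mul a
  have hd₂ := (h₂.discountable hh hy').const_mul b
  have hE₁ : M.Discountable fun t => Real.exp (-(2 * M.maxRate) * t) :=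
    discountable_exp (by positivity)
  have hE₂ : M.Discountable fun t => -1 * Real.exp (-(2 * M.maxRate + 1) * t) :=
    (discountable_exp (by positivity)).const_mul (-1)
  have hle := discounted_mono ((hd₁.add hd₂).add ((hE₁.add hE₂).const_mul W))
    (hg.discountable hh hz') fun t ht => by
      linarith [h₁.concave_gap hh ha.le hb.le hab h₂ hg hxy.le hy ht]
  rw [discounted_add (hd₁.add hd₂) ((hE₁.add hE₂).const_mul W), discounted_add hd₁ hd₂,
    discounted_const_mul, discounted_const_mul, discounted_const_mul, discounted_add hE₁ hE₂,
    discounted_const_mul, discounted_exp (by positivity), discounted_exp (by positivity)] at hle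
  have hv₁ := h₁.v_le_cost hh hx
  have hv₂ := h₂.v_le_cost hh hy0
  rw [h₁.cost_eq hh hx'] at hv₁
  rw [h₂.cost_eq hh hy'] at hv₂
  rw [hg.cost_eq hh hz']
  have e1 := mul_le_mul_of_nonneg_left hle M.aBar_pos.le
  have e2 := mul_le_mul_of_nonneg_left hv₁ ha.le
  have e3 := mul_le_mul_of_nonneg_left hv₂ hb.le
  set C := M.discounted fun t => M.c (h t)
  have e4 : a * C + b * C = C := by rw [← add_mul, hab, one_mul]
  linarith

theorem strictMonoOn_v (h0 : 0 ≤ M.hMax) : StrictMonoOn M.v (Icc 0 M.gammaMax) := by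
  intro x hx y hy hxy
  refine lt_of_lt_of_le (lt_add_of_pos_right _ ?_) (v_add_le_v h0 hx.1 hxy.le hy.2)
  exact mul_pos M.aBar_pos (mul_pos (sub_pos.2 hxy)
    (one_div_pos.2 (add_pos_of_pos_of_nonneg M.delta_pos (maxRate_nonneg h0))))

theorem strictConcaveOn_v (h0 : 0 ≤ M.hMax) : StrictConcaveOn ℝ (Icc 0 M.gammaMax) M.v := by
  refine ⟨convex_Icc _ _, fun x hx y hy hxy a b ha hb hab => ?_⟩
  simp only [smul_eq_mul]
  rcases hxy.lt_or_gt with hlt | hlt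
  · exact v_concave_gap h0 ha hb hab hx.1 hlt hy.2
  · rw [add_comm (a * _), add_comm (a * _)]
    exact v_concave_gap h0 hb ha (by rwa [add_comm]) hy.1 hlt hx.2

theorem lipschitzOnWith_v (h0 : 0 ≤ M.hMax) :
    LipschitzOnWith (Real.toNNReal M.Lv) M.v (Icc 0 M.gammaMax) := by
  have hL : 0 ≤ M.Lv := div_nonneg M.aBar_pos.le M.delta_pos.le
  refine LipschitzOnWith.of_le_add_mul _ fun x hx y hy => ?_
  rw [Real.coe_toNNReal _ hL, Real.dist_eq]
  rcases le_total x y with hxy | hxy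
  · have := (strictMonoOn_v h0).monotoneOn hx hy hxy
    have := mul_nonneg hL (abs_nonneg (x - y))
    linarith
  · rw [abs_of_nonneg (sub_nonneg.2 hxy)]
    exact v_le_v_add h0 hy.1 hxy hx.2

end Model
end InfoControl
end

theorem mainTheorem4 (M : InfoControl.Model)
    (hM0 : M.M0 ∈ M.cDeriv '' Set.Ici 0) :
    StrictMonoOn M.v (Set.Icc 0 M.gammaMax) ∧
    StrictConcaveOn ℝ (Set.Icc 0 M.gammaMax) M.v ∧
    LipschitzOnWith (Real.toNNReal M.Lv) M.v (Set.Icc 0 M.gammaMax) :=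
  have h0 := M.hMax_nonneg hM0
  ⟨M.strictMonoOn_v h0, M.strictConcaveOn_v h0, M.lipschitzOnWith_v h0⟩
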